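/- Propositional formulas are built from countably many variables with the connectives $\lor,\wedge,\to,\neg$, and $\mathrm{IPC}$ denotes the set of theorems of the intuitionistic propositional calculus. A *Brouwer algebra* is a distributive lattice with least element $0$ and largest element $1$ (operations: join $+$, meet $\times$) in which for all $a,b$ there is a least element $a\to b$ with $a+(a\to b)\ge b$; put $\neg a=a\to 1$. For a Brouwer algebra $B$ let $\mathrm{Th}(B)$ be the set of formulas that take the value $0$ under every valuation of the variables in $B$, where $\lor,\wedge,\to,\neg$ are interpreted as $\times,+,\to,\neg$. Dually, a *Heyting algebra* is a distributive lattice with $0$ and $1$ in which for all $a,b$ there is a largest element $a\to b$ with $a\times(a\to b)\le b$; put $\neg a=a\to 0$. For a Heyting algebra $H$ let $\mathrm{Th}_H(H)$ be the set of formulas that take the value $1$ under every valuation in $H$, where $\lor,\wedge,\to,\neg$ are interpreted as $+,\times,\to,\neg$. A distributive lattice $L$ is *weakly projective* if for all distributive lattices $L_0,L_1$, every surjective lattice homomorphism $f:L_0\to L_1$ and every lattice homomorphism $g:L\to L_1$ there is a lattice homomorphism $h:L\to L_0$ with $g=f\circ h$ (lattice homomorphisms preserve $+$ and $\times$, but not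 necessarily $0$ and $1$). **Corollary 3.6** (together with the two corollaries that it summarizes). $$\mathrm{IPC}=\bigcap\{\mathrm{Th}(B): B \text{ a finite Brouwer algebra, weakly projective as a distributive lattice}\},$$ $$\mathrm{IPC}=\bigcap\{\mathrm{Th}_H(H): H \text{ a finite Heyting algebra, weakly projective as a distributive lattice}\}.$$ Moreover, there is a sequence $(H_n)_{n\in\omega}$ of finite Heyting algebras, each weakly projective as a distributive lattice, with $\mathrm{IPC}=\bigcap_n\mathrm{Th}_H(H_n)$, and there is a sequence $(B_n)_{n\in\omega}$ of finite Brouwer algebras, each weakly projective as a distributive lattice, with $\mathrm{IPC}=\bigcap_n\mathrm{Th}(B_n)$. -/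

import Mathlib

universe u

/-- Propositional formulas over the variables `p₀, p₁, …`, with the connectives `∨, ∧, →, ¬`
(all four primitive). -/
inductive PropFormula : Type
  | var : ℕ → PropFormula
  | or : PropFormula → PropFormula → PropFormula
  | and : PropFormula → PropFormula → PropFormula
  | imp : PropFormula → PropFormula → PropFormula
  | neg : PropFormula → PropFormula

/-- Derivability in the intuitionistic propositional calculus: the usual Hilbert-style system
(Kleene's), given by axiom schemes and the rule of modus ponens. -/
inductive IPCProvable : PropFormula → Prop
  | imp_k (α β : PropFormula) : IPCProvable (α.imp (β.imp α))
  | imp_s (α β γ : PropFormula) :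
      IPCProvable ((α.imp (β.imp γ)).imp ((α.imp β).imp (α.imp γ)))
  | and_intro (α β : PropFormula) : IPCProvable (α.imp (β.imp (α.and β)))
  | and_left (α β : PropFormula) : IPCProvable ((α.and β).imp α)
  | and_right (α β : PropFormula) : IPCProvable ((α.and β).imp β)
  | or_inl (α β : PropFormula) : IPCProvable (α.imp (α.or β))
  | or_inr (α β : PropFormula) : IPCProvable (β.imp (α.or β))
  | or_elim (α β γ : PropFormula) :
      IPCProvable ((α.imp γ).imp ((β.imp γ).imp ((α.or β).imp γ)))
  | neg_intro (α β : PropFormula) :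
      IPCProvable ((α.imp β).imp ((α.imp β.neg).imp α.neg))
  | neg_elim (α β : PropFormula) : IPCProvable (α.neg.imp (α.imp β))
  | mp {α β : PropFormula} : IPCProvable (α.imp β) → IPCProvable α → IPCProvable β

/-- `IPC` as a set of formulas: the theorems of the intuitionistic propositional calculus. -/
def IPC : Set PropFormula := {φ | IPCProvable φ}

/-- The value of a formula in a Brouwer algebra (in Mathlib: a co-Heyting algebra).
The connectives `∨, ∧` are read as meet and join; `α → β` is read as the least `c` with
`b ≤ a ⊔ c`, which is `b \ a`; and `¬α` is read as `a → ⊤`, which is `⊤ \ a`. -/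
def PropFormula.brouwerEval {L : Type u} [CoheytingAlgebra L] (v : ℕ → L) : PropFormula → L
  | .var n => v n
  | .or φ ψ => φ.brouwerEval v ⊓ ψ.brouwerEval v
  | .and φ ψ => φ.brouwerEval v ⊔ ψ.brouwerEval v
  | .imp φ ψ => ψ.brouwerEval v \ φ.brouwerEval v
  | .neg φ => ⊤ \ φ.brouwerEval v

/-- `Th(L)`: the formulas true in the Brouwer algebra `L`, i.e. with value `⊥` under every
valuation of the variables. -/
def brouwerTh (L : Type u) [CoheytingAlgebra L] : Set PropFormula :=
  {φ | ∀ v : ℕ → L, φ.brouwerEval v = ⊥}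

/-- The value of a formula in a Heyting algebra: `∨, ∧` are read as join and meet, `α → β` as
the largest `c` with `a ⊓ c ≤ b`, and `¬α` as `a → ⊥`. -/
def PropFormula.heytingEval {L : Type u} [HeytingAlgebra L] (v : ℕ → L) : PropFormula → L
  | .var n => v n
  | .or φ ψ => φ.heytingEval v ⊔ ψ.heytingEval v
  | .and φ ψ => φ.heytingEval v ⊓ ψ.heytingEval v
  | .imp φ ψ => φ.heytingEval v ⇨ ψ.heytingEval v
  | .neg φ => φ.heytingEval v ⇨ ⊥

/-- `Th_H(L)`: the formulas true in the Heyting algebra `L`, i.e. with value `⊤` under every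
valuation of the variables. -/
def heytingTh (L : Type u) [HeytingAlgebra L] : Set PropFormula :=
  {φ | ∀ v : ℕ → L, φ.heytingEval v = ⊤}

/-- Weak projectivity in the category of distributive lattices, with the maps preserving binary
joins and meets as morphisms: every morphism out of `L` lifts along every onto morphism. -/
def WeaklyProjective (L : Type u) [DistribLattice L] : Prop :=
  ∀ (L₀ L₁ : Type u) [DistribLattice L₀] [DistribLattice L₁]
    (f : LatticeHom L₀ L₁) (g : LatticeHom L L₁), Function.Surjective f →
      ∃ h : LatticeHom L L₀, g = f.comp h

/-!
Soundness is a direct check in any Heyting algebra, and it passes to Brouwer algebras because the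
order dual exchanges the two interpretations and preserves weak projectivity. It remains to refute
each unprovable formula `φ` in a finite, weakly projective Heyting algebra.

Finite Kripke frames refuting `φ` are built from the prime theories among the subformulas of `φ`.
Unravelling such a frame into its strictly increasing chains, ordered by extension, turns it into
a finite forest, and the truth lemma survives (`PropFormula.mem_heytingEval_canonicalValuation`):
a chain forces a subformula of `φ` iff its largest theory contains it, and a chain can be extended
to end at any theory above its last one.

The algebra of persistent sets of a finite forest is weakly projective
(`weaklyProjective_lowerSet`): two principal sets are comparable or disjoint, so that these,
together with the empty set, are join-prime, generate the lattice under joins, and are closed under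
meets. Weak projectivity for every finite distributive lattice with such a set `M` of generators is
`weaklyProjective_of_inf_closed_of_join_prime`. An arbitrary choice of preimages of the members of
`M` is not compatible with meets, but it becomes so when each `a` is sent to the join of all finite
meets of chosen preimages whose indices have a meet below `a`.

The refuting algebra depends only on `φ`, and there are countably many formulas, which gives the
sequences.
-/

/-! ### Weak projectivity -/

/-- Let `M` be a meet-closed set of join-prime elements (a least element of `L` is allowed in `M`)
such that every element of the finite lattice `L` is the join of the members of `M` below it.
Given set-theoretic preimages `x m` of the values `g m` along `f`, the map
`a ↦ ⨆ {⨅ m ∈ S, x m | ∅ ≠ S ⊆ M, ⨅ S ≤ a}` is a homomorphism that lifts `g`. -/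
theorem weaklyProjective_of_inf_closed_of_join_prime {L : Type u} [DistribLattice L] [Finite L]
    (M : Set L) (hinf : ∀ a ∈ M, ∀ b ∈ M, a ⊓ b ∈ M)
    (hprime : ∀ m ∈ M, ∀ a b, m ≤ a ⊔ b → m ≤ a ∨ m ≤ b)
    (hbelow : ∀ a, ∃ m ∈ M, m ≤ a)
    (hle : ∀ a b, (∀ m ∈ M, m ≤ a → m ≤ b) → a ≤ b) : WeaklyProjective L := by
  classical
  intro L₀ L₁ _ _ f g hf
  have := Fintype.ofFinite L
  choose x hx using fun a : L => hf (g a)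
  let P := {S : Finset L // S.Nonempty ∧ ∀ m ∈ S, m ∈ M}
  let F : L → Finset P := fun a => Finset.univ.filter fun S => S.1.inf' S.2.1 id ≤ a
  have hF : ∀ a (S : P), S ∈ F a ↔ S.1.inf' S.2.1 id ≤ a := fun a S => by simp [F]
  let single : ∀ m ∈ M, P := fun m hm => ⟨{m}, by simp, by simpa using hm⟩
  have hsingle : ∀ m (hm : m ∈ M) a, m ≤ a → single m hm ∈ F a := fun m hm a h => by
    rw [hF]; simpa [single] using h
  have hFne : ∀ a, (F a).Nonempty := fun a => by
    obtain ⟨m, hm, h⟩ := hbelow a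
    exact ⟨_, hsingle m hm a h⟩
  have hFmono : ∀ {a b}, a ≤ b → F a ⊆ F b := fun h S hS => by
    rw [hF] at hS ⊢
    exact hS.trans h
  have hPM : ∀ S : P, S.1.inf' S.2.1 id ∈ M := fun S =>
    Finset.inf'_induction S.2.1 id hinf fun m hm => S.2.2 m hm
  let e : P → L₀ := fun S => S.1.inf' S.2.1 x
  let h : L → L₀ := fun a => (F a).sup' (hFne a) e
  have hmono : ∀ {a b}, a ≤ b → h a ≤ h b := fun hab => Finset.sup'_mono e (hFmono hab) _
  refine ⟨{ toFun := h, map_sup' := fun a b => ?_, map_inf' := fun a b => ?_ }, ?_⟩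
  · refine le_antisymm (Finset.sup'_le _ _ fun S hS => ?_)
      (sup_le (hmono le_sup_left) (hmono le_sup_right))
    rcases hprime _ (hPM S) a b ((hF _ _).1 hS) with h1 | h1
    · exact le_sup_of_le_left (Finset.le_sup' e ((hF _ _).2 h1))
    · exact le_sup_of_le_right (Finset.le_sup' e ((hF _ _).2 h1))
  · refine le_antisymm (le_inf (hmono inf_le_left) (hmono inf_le_right)) ?_
    rw [Finset.sup'_inf_sup']
    refine Finset.sup'_le _ _ fun ST hST => ?_
    obtain ⟨S, T⟩ := ST
    rw [Finset.mem_product, hF, hF] at hST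
    let U : P := ⟨S.1 ∪ T.1, S.2.1.inl, fun m hm =>
      (Finset.mem_union.1 hm).elim (S.2.2 m) (T.2.2 m)⟩
    have hU : U ∈ F (a ⊓ b) := by
      rw [hF]
      simp only [U, Finset.inf'_union S.2.1 T.2.1]
      exact inf_le_inf hST.1 hST.2
    refine le_of_eq_of_le ?_ (Finset.le_sup' e hU)
    exact (Finset.inf'_union S.2.1 T.2.1 x).symm
  · ext a
    change g a = f (h a)
    have he : ∀ S, f (e S) = g (S.1.inf' S.2.1 id) := fun S => by
      simp only [e, map_finset_inf']
      exact Finset.inf'_congr _ rfl fun m _ => hx m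
    have ha : (F a).sup' (hFne a) (fun S => S.1.inf' S.2.1 id) = a := by
      refine le_antisymm (Finset.sup'_le _ _ fun S hS => (hF _ _).1 hS) (hle _ _ fun m hm hma => ?_)
      refine le_of_eq_of_le ?_ (Finset.le_sup' _ (hsingle m hm a hma))
      simp [single]
    conv_lhs => rw [← ha]
    simp only [h, map_finset_sup']
    exact Finset.sup'_congr _ rfl fun S _ => (he S).symm

theorem WeaklyProjective.orderDual {L : Type u} [DistribLattice L] (hL : WeaklyProjective L) :
    WeaklyProjective Lᵒᵈ := by
  intro L₀ L₁ _ _ f g hf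
  let g' : LatticeHom L L₁ᵒᵈ :=
    { toFun a := OrderDual.toDual (g (OrderDual.toDual a))
      map_sup' a b := congrArg OrderDual.toDual
        (map_inf g (OrderDual.toDual a) (OrderDual.toDual b))
      map_inf' a b := congrArg OrderDual.toDual
        (map_sup g (OrderDual.toDual a) (OrderDual.toDual b)) }
  obtain ⟨h, hh⟩ := hL L₀ᵒᵈ L₁ᵒᵈ (LatticeHom.dual f) g' hf
  refine ⟨{ toFun a := OrderDual.ofDual (h (OrderDual.ofDual a))
            map_sup' a b := congrArg OrderDual.ofDual
              (map_inf h (OrderDual.ofDual a) (OrderDual.ofDual b))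
            map_inf' a b := congrArg OrderDual.ofDual
              (map_sup h (OrderDual.ofDual a) (OrderDual.ofDual b)) }, ?_⟩
  ext a
  exact congrArg OrderDual.ofDual (DFunLike.congr_fun hh (OrderDual.ofDual a))

/-- The lower sets of a finite forest that grows downwards form a weakly projective lattice: the
principal lower sets together with `⊥` are closed under meets, because two elements without a
comparison have no common lower bound. -/
theorem weaklyProjective_lowerSet {T : Type u} [PartialOrder T] [Finite T]
    (hT : ∀ a b c : T, c ≤ a → c ≤ b → a ≤ b ∨ b ≤ a) : WeaklyProjective (LowerSet T) := by
  have : Finite (LowerSet T) := Finite.of_injective (fun s => (s : Set T)) SetLike.coe_injective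
  refine weaklyProjective_of_inf_closed_of_join_prime
    (insert ⊥ (Set.range LowerSet.Iic)) ?_ ?_ (fun a => ⟨⊥, by simp, bot_le⟩) ?_
  · rintro a (rfl | ⟨s, rfl⟩) b (rfl | ⟨t, rfl⟩)
    · simp
    · simp
    · simp
    · by_cases hst : ∃ c, c ≤ s ∧ c ≤ t
      · obtain ⟨c, hs, ht⟩ := hst
        rcases hT s t c hs ht with h | h
        · rw [inf_eq_left.2 (LowerSet.Iic_le.2 (by simpa using h))]
          simp
        · rw [inf_eq_right.2 (LowerSet.Iic_le.2 (by simpa using h))]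
          simp
      · left
        ext c
        simpa using fun hs ht => hst ⟨c, hs, ht⟩
  · rintro m (rfl | ⟨t, rfl⟩) a b h
    · simp
    · simpa using h
  · intro a b h t ht
    exact LowerSet.Iic_le.1 (h _ (Or.inr ⟨t, rfl⟩) (LowerSet.Iic_le.2 ht))

theorem LowerSet.mem_himp_iff {T : Type u} [PartialOrder T] {A B : LowerSet T} {t : T} :
    t ∈ A ⇨ B ↔ ∀ s ≤ t, s ∈ A → s ∈ B := by
  rw [← LowerSet.Iic_le, le_himp_iff]
  exact ⟨fun h s hs hA => h ⟨hs, hA⟩, fun h s hs => h s hs.1 hs.2⟩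

/-! ### Soundness and duality -/

theorem IPCProvable.heytingEval_eq_top {L : Type u} [HeytingAlgebra L] (v : ℕ → L)
    {φ : PropFormula} (h : IPCProvable φ) : φ.heytingEval v = ⊤ := by
  induction h with
  | imp_k α β =>
    simp only [PropFormula.heytingEval, ← top_le_iff, le_himp_iff, top_inf_eq]
    exact inf_le_left
  | imp_s α β γ =>
    simp only [PropFormula.heytingEval, ← top_le_iff, le_himp_iff, top_inf_eq]
    generalize PropFormula.heytingEval v α = a
    generalize PropFormula.heytingEval v β = b
    generalize PropFormula.heytingEval v γ = c
    have hb : (a ⇨ b ⇨ c) ⊓ (a ⇨ b) ⊓ a ≤ b :=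
      (inf_le_inf_right a inf_le_right).trans himp_inf_le
    have hbc : (a ⇨ b ⇨ c) ⊓ (a ⇨ b) ⊓ a ≤ b ⇨ c :=
      (inf_le_inf_right a inf_le_left).trans himp_inf_le
    exact (le_inf hbc hb).trans himp_inf_le
  | and_intro α β => simp [PropFormula.heytingEval, ← top_le_iff, le_himp_iff]
  | and_left α β => simp [PropFormula.heytingEval, ← top_le_iff, le_himp_iff]
  | and_right α β => simp [PropFormula.heytingEval, ← top_le_iff, le_himp_iff]
  | or_inl α β => simp [PropFormula.heytingEval, ← top_le_iff, le_himp_iff]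
  | or_inr α β => simp [PropFormula.heytingEval, ← top_le_iff, le_himp_iff]
  | or_elim α β γ =>
    simp only [PropFormula.heytingEval, ← top_le_iff, le_himp_iff, top_inf_eq, inf_sup_left]
    exact sup_le ((inf_le_inf_right _ inf_le_left).trans himp_inf_le)
      ((inf_le_inf_right _ inf_le_right).trans himp_inf_le)
  | neg_intro α β =>
    simp only [PropFormula.heytingEval, ← top_le_iff, le_himp_iff, top_inf_eq]
    generalize PropFormula.heytingEval v α = a
    generalize PropFormula.heytingEval v β = b
    have hb : (a ⇨ b) ⊓ (a ⇨ b ⇨ ⊥) ⊓ a ≤ b :=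
      (inf_le_inf_right a inf_le_left).trans himp_inf_le
    have hbc : (a ⇨ b) ⊓ (a ⇨ b ⇨ ⊥) ⊓ a ≤ b ⇨ ⊥ :=
      (inf_le_inf_right a inf_le_right).trans himp_inf_le
    exact (le_inf hbc hb).trans himp_inf_le
  | neg_elim α β =>
    simp only [PropFormula.heytingEval, ← top_le_iff, le_himp_iff, top_inf_eq]
    exact himp_inf_le.trans bot_le
  | mp _ _ h1 h2 => simpa [PropFormula.heytingEval, h2] using h1

theorem PropFormula.heytingEval_orderDual {B : Type u} [CoheytingAlgebra B] (v : ℕ → B)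
    (φ : PropFormula) :
    φ.heytingEval (fun n => OrderDual.toDual (v n)) = OrderDual.toDual (φ.brouwerEval v) := by
  induction φ with
  | var n => rfl
  | or α β h1 h2 => simp only [heytingEval, brouwerEval, h1, h2]; rfl
  | and α β h1 h2 => simp only [heytingEval, brouwerEval, h1, h2]; rfl
  | imp α β h1 h2 => simp only [heytingEval, brouwerEval, h1, h2]; rfl
  | neg α h1 => simp only [heytingEval, brouwerEval, h1]; rfl

theorem PropFormula.brouwerEval_orderDual {H : Type u} [HeytingAlgebra H] (v : ℕ → H)
    (φ : PropFormula) :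
    φ.brouwerEval (fun n => OrderDual.toDual (v n)) = OrderDual.toDual (φ.heytingEval v) := by
  induction φ with
  | var n => rfl
  | or α β h1 h2 => simp only [heytingEval, brouwerEval, h1, h2]; rfl
  | and α β h1 h2 => simp only [heytingEval, brouwerEval, h1, h2]; rfl
  | imp α β h1 h2 => simp only [heytingEval, brouwerEval, h1, h2]; rfl
  | neg α h1 => simp only [heytingEval, brouwerEval, h1]; rfl

theorem IPC_subset_heytingTh (H : Type u) [HeytingAlgebra H] : IPC ⊆ heytingTh H :=
  fun _ h v => IPCProvable.heytingEval_eq_top v h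

theorem IPC_subset_brouwerTh (B : Type u) [CoheytingAlgebra B] : IPC ⊆ brouwerTh B :=
  fun φ h v => OrderDual.toDual.injective <|
    (φ.heytingEval_orderDual v).symm.trans (IPCProvable.heytingEval_eq_top _ h)

theorem brouwerTh_orderDual_subset (H : Type u) [HeytingAlgebra H] :
    brouwerTh Hᵒᵈ ⊆ heytingTh H :=
  fun φ h v => OrderDual.toDual.injective <|
    (φ.brouwerEval_orderDual v).symm.trans (h _)

/-! ### Derivations from hypotheses and prime theories -/

/-- Derivability in the intuitionistic propositional calculus from a set `Γ` of hypotheses. -/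
inductive IPCDerivable (Γ : Set PropFormula) : PropFormula → Prop
  | of_provable {α : PropFormula} : IPCProvable α → IPCDerivable Γ α
  | hyp {α : PropFormula} : α ∈ Γ → IPCDerivable Γ α
  | mp {α β : PropFormula} : IPCDerivable Γ (α.imp β) → IPCDerivable Γ α → IPCDerivable Γ β

namespace IPCDerivable

theorem provable {α : PropFormula} (h : IPCDerivable ∅ α) : IPCProvable α := by
  induction h with
  | of_provable h => exact h
  | hyp h => exact h.elim
  | mp _ _ h1 h2 => exact h1.mp h2

/-- The deduction theorem. -/
theorem deduction {Γ : Set PropFormula} {α β : PropFormula} (h : IPCDerivable (insert α Γ) β) :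
    IPCDerivable Γ (α.imp β) := by
  induction h with
  | of_provable h => exact of_provable ((IPCProvable.imp_k _ _).mp h)
  | @hyp γ h =>
    rcases h with rfl | h
    · exact of_provable (((IPCProvable.imp_s γ (γ.imp γ) γ).mp (.imp_k _ _)).mp (.imp_k _ _))
    · exact (of_provable (.imp_k _ _)).mp (hyp h)
  | mp _ _ h1 h2 => exact ((of_provable (.imp_s _ _ _)).mp h1).mp h2

end IPCDerivable

/-- A prime theory relative to a set `S` of formulas: a consistent subset of `S` that contains
all its consequences in `S` and has the disjunction property for the disjunctions in `S` whose
members lie in `S`. The universe is a parameter, since the statement quantifies over algebras in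
an arbitrary one. -/
structure PrimeTheory (S : Set PropFormula) : Type u where
  carrier : Set PropFormula
  subset : carrier ⊆ S
  closed : ∀ α ∈ S, IPCDerivable carrier α → α ∈ carrier
  prime : ∀ α β : PropFormula, α ∈ S → β ∈ S → IPCDerivable carrier (α.or β) →
    α ∈ carrier ∨ β ∈ carrier
  consistent : ∃ α, ¬ IPCDerivable carrier α

namespace PrimeTheory

variable {S : Set PropFormula}

theorem carrier_injective : Function.Injective (carrier : PrimeTheory.{u} S → Set PropFormula) := by
  rintro ⟨_, _, _, _, _⟩ ⟨_, _, _, _, _⟩ rfl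
  rfl

instance : PartialOrder (PrimeTheory.{u} S) := PartialOrder.lift carrier carrier_injective

theorem finite (hS : S.Finite) : Finite (PrimeTheory.{u} S) :=
  have := hS.finite_subsets.to_subtype
  Finite.of_injective (fun Γ => (⟨Γ.carrier, Γ.subset⟩ : {Γ : Set PropFormula | Γ ⊆ S}))
    fun _ _ h => carrier_injective (congrArg Subtype.val h)

/-- Lindenbaum's lemma: a subset of `S` that is maximal among those not deriving `χ` is prime. -/
theorem exists_extension (hS : S.Finite) {Γ : Set PropFormula} (hΓ : Γ ⊆ S) {χ : PropFormula}
    (hχ : ¬ IPCDerivable Γ χ) :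
    ∃ Δ : PrimeTheory.{u} S, Γ ⊆ Δ.carrier ∧ ¬ IPCDerivable Δ.carrier χ := by
  have hfin : {Δ : Set PropFormula | Δ ⊆ S ∧ ¬ IPCDerivable Δ χ}.Finite :=
    hS.finite_subsets.subset fun _ h => h.1
  obtain ⟨Δ, hΓΔ, hΔ⟩ := hfin.exists_le_maximal (a := Γ) ⟨hΓ, hχ⟩
  have key : ∀ α ∈ S, α ∉ Δ → IPCDerivable Δ (α.imp χ) := fun α hα hαΔ => by
    by_contra hcon
    refine hαΔ (hΔ.2 (y := insert α Δ) ⟨Set.insert_subset hα hΔ.1.1, fun h => hcon h.deduction⟩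
      (Set.subset_insert _ _) (Set.mem_insert _ _))
  refine ⟨⟨Δ, hΔ.1.1, fun α hα h => ?_, fun α β hα hβ h => ?_, χ, hΔ.1.2⟩, hΓΔ, hΔ.1.2⟩
  · by_contra hαΔ
    exact hΔ.1.2 ((key α hα hαΔ).mp h)
  · by_contra! hcon
    exact hΔ.1.2 ((((IPCDerivable.of_provable (.or_elim α β χ)).mp (key α hα hcon.1)).mp
      (key β hβ hcon.2)).mp h)

theorem and_mem_iff (Γ : PrimeTheory.{u} S) {α β : PropFormula} (h : α.and β ∈ S) (hα : α ∈ S)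
    (hβ : β ∈ S) : α.and β ∈ Γ.carrier ↔ α ∈ Γ.carrier ∧ β ∈ Γ.carrier :=
  ⟨fun hm => ⟨Γ.closed _ hα ((IPCDerivable.of_provable (.and_left _ _)).mp (.hyp hm)),
    Γ.closed _ hβ ((IPCDerivable.of_provable (.and_right _ _)).mp (.hyp hm))⟩,
   fun hm => Γ.closed _ h
    (((IPCDerivable.of_provable (.and_intro _ _)).mp (.hyp hm.1)).mp (.hyp hm.2))⟩

theorem or_mem_iff (Γ : PrimeTheory.{u} S) {α β : PropFormula} (h : α.or β ∈ S) (hα : α ∈ S)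
    (hβ : β ∈ S) : α.or β ∈ Γ.carrier ↔ α ∈ Γ.carrier ∨ β ∈ Γ.carrier := by
  refine ⟨fun hm => Γ.prime _ _ hα hβ (.hyp hm), ?_⟩
  rintro (hm | hm)
  · exact Γ.closed _ h ((IPCDerivable.of_provable (.or_inl _ _)).mp (.hyp hm))
  · exact Γ.closed _ h ((IPCDerivable.of_provable (.or_inr _ _)).mp (.hyp hm))

theorem imp_mem_iff (hS : S.Finite) (Γ : PrimeTheory.{u} S) {α β : PropFormula}
    (h : α.imp β ∈ S) (hα : α ∈ S) (hβ : β ∈ S) :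
    α.imp β ∈ Γ.carrier ↔ ∀ Δ ≥ Γ, α ∈ Δ.carrier → β ∈ Δ.carrier := by
  refine ⟨fun hm Δ hΔ hαΔ => Δ.closed _ hβ ((IPCDerivable.hyp (hΔ hm)).mp (.hyp hαΔ)),
    fun H => ?_⟩
  by_contra hm
  obtain ⟨Δ, hΔ, hβΔ⟩ := exists_extension (Γ := insert α Γ.carrier) hS
    (Set.insert_subset hα Γ.subset) fun hd => hm (Γ.closed _ h hd.deduction)
  exact hβΔ (.hyp (H Δ ((Set.subset_insert _ _).trans hΔ) (hΔ (Set.mem_insert _ _))))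

theorem neg_mem_iff (hS : S.Finite) (Γ : PrimeTheory.{u} S) {α : PropFormula}
    (h : α.neg ∈ S) (hα : α ∈ S) :
    α.neg ∈ Γ.carrier ↔ ∀ Δ ≥ Γ, α ∉ Δ.carrier := by
  refine ⟨fun hm Δ hΔ hαΔ => ?_, fun H => ?_⟩
  · obtain ⟨χ, hχ⟩ := Δ.consistent
    exact hχ (((IPCDerivable.of_provable (.neg_elim α χ)).mp (.hyp (hΔ hm))).mp (.hyp hαΔ))
  · by_contra hm
    have hcons : ¬ IPCDerivable (insert α Γ.carrier) α.neg := fun hd =>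
      -- `α → ¬α` together with `α → α` gives `¬α`.
      hm (Γ.closed _ h (((IPCDerivable.of_provable (.neg_intro α α)).mp
        (IPCDerivable.hyp (Set.mem_insert _ _)).deduction).mp hd.deduction))
    obtain ⟨Δ, hΔ, -⟩ := exists_extension (Γ := insert α Γ.carrier) hS
      (Set.insert_subset hα Γ.subset) hcons
    exact H Δ ((Set.subset_insert _ _).trans hΔ) (hΔ (Set.mem_insert _ _))

end PrimeTheory

/-! ### The forest of chains of a finite poset -/

/-- The nonempty finite chains of `W`, encoded as strictly decreasing lists, so that the head is
the largest element of the chain. -/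
def DescendingChain (W : Type u) [PartialOrder W] : Type u :=
  {l : List W // l ≠ [] ∧ l.Pairwise (· > ·)}

namespace DescendingChain

variable {W : Type u} [PartialOrder W]

/-- The order is reverse extension: `a ≤ b` if `a` arises from `b` by adding larger elements. -/
instance : PartialOrder (DescendingChain W) where
  le a b := b.1 <:+ a.1
  le_refl a := List.suffix_refl _
  le_trans a b c hab hbc := List.IsSuffix.trans hbc hab
  le_antisymm a b hab hba :=
    Subtype.ext (hba.eq_of_length (le_antisymm hba.length_le hab.length_le))

/-- The largest element of a chain. -/
def head (a : DescendingChain W) : W := a.1.head a.2.1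

theorem le_total_of_le {a b c : DescendingChain W} (ha : c ≤ a) (hb : c ≤ b) : a ≤ b ∨ b ≤ a :=
  (List.suffix_or_suffix_of_suffix ha hb).symm

theorem head_le_head {a b : DescendingChain W} (h : a ≤ b) : b.head ≤ a.head := by
  obtain ⟨a, ha, ha'⟩ := a
  obtain ⟨b, hb, hb'⟩ := b
  obtain ⟨p, rfl : p ++ b = a⟩ := h
  cases p with
  | nil => exact le_rfl
  | cons w p =>
    exact ((List.pairwise_cons.1 ha').1 (b.head hb) (by simp)).le

theorem exists_le_head_eq (a : DescendingChain W) {w : W} (h : a.head ≤ w) :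
    ∃ b ≤ a, b.head = w := by
  rcases h.eq_or_lt with rfl | h
  · exact ⟨a, le_rfl, rfl⟩
  · refine ⟨⟨w :: a.1, by simp, List.pairwise_cons.2 ⟨fun x hx => ?_, a.2.2⟩⟩,
      List.suffix_cons _ _, rfl⟩
    refine lt_of_le_of_lt ?_ h
    obtain ⟨_ | ⟨y, l⟩, hl, hp⟩ := a
    · exact absurd rfl hl
    · rcases List.mem_cons.1 hx with rfl | hx
      · exact le_rfl
      · exact ((List.pairwise_cons.1 hp).1 x hx).le

theorem forall_ge_head_iff (a : DescendingChain W) (p : W → Prop) :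
    (∀ b ≤ a, p b.head) ↔ ∀ w ≥ a.head, p w := by
  refine ⟨fun H w hw => ?_, fun H b hb => H _ (head_le_head hb)⟩
  obtain ⟨b, hb, rfl⟩ := a.exists_le_head_eq hw
  exact H b hb

instance [Finite W] : Finite (DescendingChain W) := by
  classical
  have := Fintype.ofFinite W
  refine Finite.of_injective
    (fun a : DescendingChain W => (⟨a.1, a.2.2.imp fun h => ne_of_gt h⟩ : {l : List W // l.Nodup}))
    fun a b h => Subtype.ext (congrArg (fun l : {l : List W // l.Nodup} => l.1) h)

end DescendingChain

/-! ### Completeness for the algebras of lower sets of chains of prime theories -/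

namespace PropFormula

/-- The subformulas of a formula, itself included; `¬α` counts only `α` and itself, not `⊥`. -/
def subformulas : PropFormula → Set PropFormula
  | .var n => {.var n}
  | .or α β => insert (.or α β) (α.subformulas ∪ β.subformulas)
  | .and α β => insert (.and α β) (α.subformulas ∪ β.subformulas)
  | .imp α β => insert (.imp α β) (α.subformulas ∪ β.subformulas)
  | .neg α => insert (.neg α) α.subformulas

theorem mem_subformulas_self (φ : PropFormula) : φ ∈ φ.subformulas := by
  cases φ <;> simp [subformulas]

theorem finite_subformulas (φ : PropFormula) : φ.subformulas.Finite := by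
  induction φ <;> simp_all [subformulas]

/-- An injective numbering of formulas. -/
def code : PropFormula → ℕ
  | .var n => Nat.pair 0 n
  | .or α β => Nat.pair 1 (Nat.pair α.code β.code)
  | .and α β => Nat.pair 2 (Nat.pair α.code β.code)
  | .imp α β => Nat.pair 3 (Nat.pair α.code β.code)
  | .neg α => Nat.pair 4 α.code

theorem code_injective : Function.Injective code := by
  intro φ
  induction φ with
  | var n => intro ψ h; cases ψ <;> simp_all [code]
  | or α β h1 h2 | and α β h1 h2 | imp α β h1 h2 =>
    intro ψ h
    cases ψ <;> simp only [code, Nat.pair_eq_pair] at h <;> first | omega | skip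
    rw [h1 h.2.1, h2 h.2.2]
  | neg α h1 =>
    intro ψ h
    cases ψ <;> simp only [code, Nat.pair_eq_pair] at h <;> first | omega | skip
    rw [h1 h.2]

instance : Countable PropFormula := code_injective.countable

/-- The algebra of lower sets of the forest of chains of prime theories among the subformulas of
`φ`. Since larger chains are smaller in the order, its elements are the persistent sets of the
Kripke frame of these chains ordered by extension. -/
abbrev ChainAlgebra (φ : PropFormula) : Type u :=
  LowerSet (DescendingChain (PrimeTheory.{u} φ.subformulas))

instance finite_primeTheory_subformulas (φ : PropFormula) :
    Finite (PrimeTheory.{u} φ.subformulas) :=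
  PrimeTheory.finite φ.finite_subformulas

instance finite_chainAlgebra (φ : PropFormula) : Finite (ChainAlgebra.{u} φ) :=
  Finite.of_injective (SetLike.coe : ChainAlgebra.{u} φ → Set _) SetLike.coe_injective

theorem weaklyProjective_chainAlgebra (φ : PropFormula) :
    WeaklyProjective (ChainAlgebra.{u} φ) :=
  weaklyProjective_lowerSet fun _ _ _ => DescendingChain.le_total_of_le

/-- A variable holds at the chains whose largest theory contains it. -/
def canonicalValuation (S : Set PropFormula) (n : ℕ) :
    LowerSet (DescendingChain (PrimeTheory.{u} S)) where
  carrier := {a | .var n ∈ a.head.carrier}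
  lower' := fun _ _ h ha => DescendingChain.head_le_head h ha

/-- The truth lemma. -/
theorem mem_heytingEval_canonicalValuation {S : Set PropFormula} (hS : S.Finite) (ψ : PropFormula)
    (hψ : ψ.subformulas ⊆ S) (a : DescendingChain (PrimeTheory.{u} S)) :
    a ∈ ψ.heytingEval (canonicalValuation S) ↔ ψ ∈ a.head.carrier := by
  have hself := hψ ψ.mem_subformulas_self
  induction ψ generalizing a with
  | var n => rfl
  | or α β h1 h2 =>
    have hα : α.subformulas ⊆ S := (Set.subset_union_left.trans (Set.subset_insert _ _)).trans hψ
    have hβ : β.subformulas ⊆ S := (Set.subset_union_right.trans (Set.subset_insert _ _)).trans hψ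
    have hα' := hα α.mem_subformulas_self
    have hβ' := hβ β.mem_subformulas_self
    exact LowerSet.mem_sup_iff.trans <| (or_congr (h1 hα a hα') (h2 hβ a hβ')).trans
      (PrimeTheory.or_mem_iff _ hself hα' hβ').symm
  | and α β h1 h2 =>
    have hα : α.subformulas ⊆ S := (Set.subset_union_left.trans (Set.subset_insert _ _)).trans hψ
    have hβ : β.subformulas ⊆ S := (Set.subset_union_right.trans (Set.subset_insert _ _)).trans hψ
    have hα' := hα α.mem_subformulas_self
    have hβ' := hβ β.mem_subformulas_self
    exact LowerSet.mem_inf_iff.trans <| (and_congr (h1 hα a hα') (h2 hβ a hβ')).trans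
      (PrimeTheory.and_mem_iff _ hself hα' hβ').symm
  | imp α β h1 h2 =>
    have hα : α.subformulas ⊆ S := (Set.subset_union_left.trans (Set.subset_insert _ _)).trans hψ
    have hβ : β.subformulas ⊆ S := (Set.subset_union_right.trans (Set.subset_insert _ _)).trans hψ
    have hα' := hα α.mem_subformulas_self
    have hβ' := hβ β.mem_subformulas_self
    rw [heytingEval, LowerSet.mem_himp_iff, PrimeTheory.imp_mem_iff hS _ hself hα' hβ',
      ← a.forall_ge_head_iff fun Δ => α ∈ Δ.carrier → β ∈ Δ.carrier]
    simp only [h1 hα _ hα', h2 hβ _ hβ']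
  | neg α h1 =>
    have hα : α.subformulas ⊆ S := (Set.subset_insert _ _).trans hψ
    have hα' := hα α.mem_subformulas_self
    rw [heytingEval, LowerSet.mem_himp_iff, PrimeTheory.neg_mem_iff hS _ hself hα',
      ← a.forall_ge_head_iff fun Δ => α ∉ Δ.carrier]
    simp only [h1 hα _ hα', LowerSet.notMem_bot, imp_false]

theorem mem_IPC_of_mem_heytingTh_chainAlgebra {φ : PropFormula}
    (h : φ ∈ heytingTh (ChainAlgebra.{u} φ)) : φ ∈ IPC := by
  by_contra hφ
  obtain ⟨Δ, -, hΔ⟩ := PrimeTheory.exists_extension.{u} φ.finite_subformulas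
    (Set.empty_subset _) fun hd => hφ hd.provable
  let a : DescendingChain (PrimeTheory.{u} φ.subformulas) := ⟨[Δ], by simp, by simp⟩
  have ha : a ∈ φ.heytingEval (canonicalValuation φ.subformulas) := by
    rw [h]
    exact LowerSet.mem_top
  exact hΔ (.hyp ((mem_heytingEval_canonicalValuation φ.finite_subformulas φ subset_rfl a).1 ha))

end PropFormula

theorem corollary3p6 :
    (IPC = ⋂ (B : Type u) (_ : CoheytingAlgebra B) (_ : Finite B) (_ : WeaklyProjective B),
      brouwerTh B) ∧
    (IPC = ⋂ (H : Type u) (_ : HeytingAlgebra H) (_ : Finite H) (_ : WeaklyProjective H),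
      heytingTh H) ∧
    (∃ (B : ℕ → Type u) (_ : ∀ n, CoheytingAlgebra (B n)),
      (∀ n, Finite (B n)) ∧ (∀ n, WeaklyProjective (B n)) ∧ IPC = ⋂ n, brouwerTh (B n)) ∧
    (∃ (H : ℕ → Type u) (_ : ∀ n, HeytingAlgebra (H n)),
      (∀ n, Finite (H n)) ∧ (∀ n, WeaklyProjective (H n)) ∧ IPC = ⋂ n, heytingTh (H n)) := by
  have : Nonempty PropFormula := ⟨.var 0⟩
  obtain ⟨φ, hφ⟩ := exists_surjective_nat PropFormula
  refine ⟨?_, ?_, ?_, ?_⟩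
  · refine subset_antisymm ?_ fun ψ hψ => ?_
    · simp only [Set.subset_iInter_iff]
      exact fun B _ _ _ => IPC_subset_brouwerTh B
    · simp only [Set.mem_iInter] at hψ
      exact PropFormula.mem_IPC_of_mem_heytingTh_chainAlgebra <| brouwerTh_orderDual_subset _ <|
        hψ (PropFormula.ChainAlgebra.{u} ψ)ᵒᵈ inferInstance inferInstance
          ψ.weaklyProjective_chainAlgebra.orderDual
  · refine subset_antisymm ?_ fun ψ hψ => ?_
    · simp only [Set.subset_iInter_iff]
      exact fun H _ _ _ => IPC_subset_heytingTh H
    · simp only [Set.mem_iInter] at hψ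
      exact PropFormula.mem_IPC_of_mem_heytingTh_chainAlgebra <|
        hψ (PropFormula.ChainAlgebra.{u} ψ) inferInstance inferInstance
          ψ.weaklyProjective_chainAlgebra
  · refine ⟨fun n => (φ n).ChainAlgebraᵒᵈ, fun n => inferInstance, fun n => inferInstance,
      fun n => (φ n).weaklyProjective_chainAlgebra.orderDual,
      subset_antisymm (Set.subset_iInter fun n => IPC_subset_brouwerTh _) fun ψ hψ => ?_⟩
    obtain ⟨n, rfl⟩ := hφ ψ
    exact PropFormula.mem_IPC_of_mem_heytingTh_chainAlgebra <| brouwerTh_orderDual_subset _ <|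
      Set.mem_iInter.1 hψ n
  · refine ⟨fun n => (φ n).ChainAlgebra, fun n => inferInstance, fun n => inferInstance,
      fun n => (φ n).weaklyProjective_chainAlgebra,
      subset_antisymm (Set.subset_iInter fun n => IPC_subset_heytingTh _) fun ψ hψ => ?_⟩
    obtain ⟨n, rfl⟩ := hφ ψ
    exact PropFormula.mem_IPC_of_mem_heytingTh_chainAlgebra <| Set.mem_iInter.1 hψ n
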